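/- Let $\Gamma$ be a finite, connected, vertex-transitive simple graph (no loops, no multiple edges) with vertex set $V$, $|V|\ge 2$, adjacency matrix $\epsilon$, degrees $d_i$, volume $\mathcal V=\sum_{i\in V} d_i$ and diameter $D$. A path with $m$ vertices is a tuple $(i_1,\dots,i_m)\in V^m$ whose consecutive entries are adjacent (repetitions allowed). For a natural number $k$ let $C(\mathbb G_k^+(\Gamma))$ be the universal unital $C^*$-algebra generated by self-adjoint elements $q_{ij}$ ($i,j\in V$) subject to the relations $$\sum_j q_{ij}=1=\sum_j q_{ji},\qquad q_{ij}q_{il}=\delta_{jl}q_{ij},\qquad q_{ji}q_{li}=\delta_{jl}q_{ji},\qquad q\epsilon=\epsilon q,$$ and $$q_{i_1j_1}q_{i_2j_2}\cdots q_{i_\beta j_\beta}=q_{i_\beta j_\beta}\cdots q_{i_2j_2}q_{i_1j_1}$$ for all $\beta\le k+1$ and all paths $(i_1,\dots,i_\beta)$, $(j_1,\dots,j_\beta)$. Two paths with $m$ vertices are called $k$-equivalent, written $(i_1,\dots,i_m)\sim^k(j_1,\dots,j_m)$, if $q_{i_1j_1}\cdots q_{i_mj_m}\ne 0$ in $C(\mathbb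 G_k^+(\Gamma))$. Regarding an edge as a path $(i_1,i_2)$ of length one (an ordered pair of adjacent vertices), let $r_k$ be the minimal cardinality of a $\sim^k$-class $\{f : f \text{ an edge},\ e\sim^k f\}$ of an edge $e$, and put $\mathrm{ind}_k(\Gamma)=\mathcal V/r_k$. Let $\mathcal L$ be the normalized Laplacian, $\mathcal L(i,i)=1$ if $d_i\neq 0$, $\mathcal L(i,j)=-1/\sqrt{d_id_j}$ if $i$ and $j$ are adjacent, and $\mathcal L(i,j)=0$ otherwise, with eigenvalues $0=\lambda_0\le\lambda_1\le\dots\le\lambda_{|V|-1}$ counted with multiplicity. If $D\le 2k+1$, then $$\lambda_1\ \ge\ \frac{1}{D^2\,\mathrm{ind}_k(\Gamma)}.$$ -/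

import Mathlib

open scoped ENNReal

noncomputable section

namespace QSym

universe u v

/-! ### Paths, vertex transitivity, volume, normalized Laplacian -/

section Graph

variable {V : Type u}

/-- `(i₁, …, i_m)` is a path of the graph `G` (with `m` vertices, hence of length `m - 1`):
consecutive vertices are adjacent. Repetitions of vertices are allowed. -/
def IsPath (G : SimpleGraph V) {m : ℕ} (i : Fin m → V) : Prop :=
  ∀ s t : Fin m, (s : ℕ) + 1 = (t : ℕ) → G.Adj (i s) (i t)

/-- Any vertex can be moved to any other one by an automorphism of the graph. -/
def IsVertexTransitive (G : SimpleGraph V) : Prop :=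
  ∀ x y : V, ∃ φ : G ≃g G, φ x = y

/-- The volume of a finite graph: the sum of all its vertex degrees. -/
def volume [Fintype V] (G : SimpleGraph V) [DecidableRel G.Adj] : ℕ :=
  ∑ x : V, G.degree x

/-- The normalized Laplacian: `1` on the diagonal at vertices of nonzero degree,
`-1 / √(d_x d_y)` at adjacent `x, y`, and `0` elsewhere. -/
def normalizedLaplacian [Fintype V] [DecidableEq V] (G : SimpleGraph V) [DecidableRel G.Adj] :
    Matrix V V ℝ :=
  Matrix.of fun x y =>
    if x = y ∧ G.degree x ≠ 0 then 1
    else if G.Adj x y then -(1 / Real.sqrt ((G.degree x : ℝ) * (G.degree y : ℝ)))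
    else 0

theorem normalizedLaplacian_isHermitian [Fintype V] [DecidableEq V] (G : SimpleGraph V)
    [DecidableRel G.Adj] : (normalizedLaplacian G).IsHermitian := by
  ext x y
  by_cases h : x = y
  · subst h
    simp [normalizedLaplacian]
  · simp [normalizedLaplacian, h, Ne.symm h, G.adj_comm x y, mul_comm]

/-- The eigenvalues `λ₀ ≤ λ₁ ≤ … ≤ λ_{n-1}` of the normalized Laplacian, listed in increasing
order and with multiplicities (`eigenvalues₀` lists them in decreasing order). -/
def laplacianEigenvalue [Fintype V] [DecidableEq V] (G : SimpleGraph V) [DecidableRel G.Adj]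
    (m : Fin (Fintype.card V)) : ℝ :=
  (normalizedLaplacian_isHermitian G).eigenvalues₀ m.rev

/-- The eigenvalue `λ₁` of a graph with at least two vertices. -/
def lambdaOne [Fintype V] [DecidableEq V] [Nontrivial V] (G : SimpleGraph V)
    [DecidableRel G.Adj] : ℝ :=
  laplacianEigenvalue G ⟨1, Fintype.one_lt_card⟩

end Graph

/-! ### The C⋆-algebra of the quantum group `𝔾ₖ⁺(Γ)` -/

section QuantumGroup

variable {V : Type u} [Fintype V]

/-- The product `q_{i₁j₁} q_{i₂j₂} ⋯ q_{i_m j_m}`, in this order. -/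
def word {B : Type v} [Monoid B] (q : V → V → B) {m : ℕ} (i j : Fin m → V) : B :=
  (List.ofFn fun t => q (i t) (j t)).prod

/-- The product `q_{i_m j_m} ⋯ q_{i₂j₂} q_{i₁j₁}`, in the opposite order. -/
def revWord {B : Type v} [Monoid B] (q : V → V → B) {m : ℕ} (i j : Fin m → V) : B :=
  (List.ofFn fun t => q (i t) (j t)).reverse.prod

/-- The defining relations of `C(𝔾ₖ⁺(Γ))`: the relations of the quantum permutation group,
commutation with the vertex matrix (quantum automorphism group in the sense of Banica), and
reversal of the products along pairs of paths with at most `k + 1` vertices. -/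
structure Relations (G : SimpleGraph V) [DecidableRel G.Adj] (k : ℕ) {B : Type v} [Ring B]
    [StarRing B] (q : V → V → B) : Prop where
  selfAdjoint : ∀ i j, star (q i j) = q i j
  sum_row : ∀ i, ∑ j, q i j = 1
  sum_col : ∀ i, ∑ j, q j i = 1
  idem : ∀ i j, q i j * q i j = q i j
  row_orthogonal : ∀ i j l, j ≠ l → q i j * q i l = 0
  col_orthogonal : ∀ i j l, j ≠ l → q j i * q l i = 0
  commute_adj : Matrix.of q * G.adjMatrix B = G.adjMatrix B * Matrix.of q
  reversal : ∀ m : ℕ, m ≤ k + 1 → ∀ i j : Fin m → V, IsPath G i → IsPath G j →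
    word q i j = revWord q i j

/-- A representation of the relations in a C⋆-algebra. A C⋆-algebra generated by finitely many
elements is separable, hence isomorphic to one whose carrier is in `Type`, so that all
representations occur here up to isomorphism (of the algebra generated by the `q i j`). -/
structure Rep (G : SimpleGraph V) [DecidableRel G.Adj] (k : ℕ) where
  carrier : Type
  [cstar : CStarAlgebra carrier]
  [nontriv : Nontrivial carrier]
  q : V → V → carrier
  rel : Relations G k q

instance (G : SimpleGraph V) [DecidableRel G.Adj] (k : ℕ) (r : Rep G k) :
    CStarAlgebra r.carrier := r.cstar

instance (G : SimpleGraph V) [DecidableRel G.Adj] (k : ℕ) (r : Rep G k) :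
    Nontrivial r.carrier := r.nontriv

/-- The C⋆-algebra of all bounded families indexed by the representations of the relations. -/
abbrev RepProduct (G : SimpleGraph V) [DecidableRel G.Adj] (k : ℕ) : Type (max u 1) :=
  lp (fun r : Rep G k => r.carrier) ∞

instance (G : SimpleGraph V) [DecidableRel G.Adj] (k : ℕ) : CStarAlgebra (RepProduct G k) where

theorem norm_q_le_one {G : SimpleGraph V} [DecidableRel G.Adj] {k : ℕ} (r : Rep G k)
    (i j : V) : ‖r.q i j‖ ≤ 1 := by
  have h : ‖r.q i j‖ = ‖r.q i j‖ * ‖r.q i j‖ := by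
    conv_lhs => rw [← r.rel.idem i j]
    have h2 := CStarRing.norm_star_mul_self (x := r.q i j)
    rwa [r.rel.selfAdjoint] at h2
  nlinarith [norm_nonneg (r.q i j)]

/-- The family of all the generators `q i j`, one for each representation. -/
def repGen (G : SimpleGraph V) [DecidableRel G.Adj] (k : ℕ) (i j : V) : RepProduct G k :=
  ⟨fun r => r.q i j, memℓp_infty ⟨1, by rintro _ ⟨r, rfl⟩; exact norm_q_le_one r i j⟩⟩

/-- `C(𝔾ₖ⁺(Γ))`, the universal C⋆-algebra generated by elements `q i j` subject to the relations
above: the C⋆-subalgebra generated by the universal family in the product of all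
representations. -/
def algebra (G : SimpleGraph V) [DecidableRel G.Adj] (k : ℕ) :
    StarSubalgebra ℂ (RepProduct G k) :=
  (StarAlgebra.adjoin ℂ (Set.range fun e : V × V => repGen G k e.1 e.2)).topologicalClosure

/-- The type of elements of `C(𝔾ₖ⁺(Γ))`. -/
abbrev CQ (G : SimpleGraph V) [DecidableRel G.Adj] (k : ℕ) : Type (max u 1) :=
  algebra G k

instance (G : SimpleGraph V) [DecidableRel G.Adj] (k : ℕ) : CStarAlgebra (CQ G k) :=
  StarSubalgebra.cstarAlgebra _ (h_closed := StarSubalgebra.isClosed_topologicalClosure _)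

/-- The canonical generators of `C(𝔾ₖ⁺(Γ))`. -/
def gen (G : SimpleGraph V) [DecidableRel G.Adj] (k : ℕ) (i j : V) : CQ G k :=
  ⟨repGen G k i j,
    StarSubalgebra.le_topologicalClosure _ (StarAlgebra.subset_adjoin ℂ _ ⟨(i, j), rfl⟩)⟩

/-! ### The relation `∼ᵏ` and the index `indₖ(Γ)` -/

/-- `k`-equivalence of two paths with `m` vertices: `q_{i₁j₁} ⋯ q_{i_m j_m} ≠ 0` in
`C(𝔾ₖ⁺(Γ))`. -/
def PathEquiv (G : SimpleGraph V) [DecidableRel G.Adj] (k : ℕ) {m : ℕ} (i j : Fin m → V) : Prop :=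
  IsPath G i ∧ IsPath G j ∧ word (gen G k) i j ≠ 0

/-- The `∼ᵏ`-equivalence class of an edge, an edge being a path of length one, that is,
an ordered pair of adjacent vertices. -/
def edgeClass (G : SimpleGraph V) [DecidableRel G.Adj] (k : ℕ) (e : Fin 2 → V) :
    Set (Fin 2 → V) :=
  {f | PathEquiv G k e f}

/-- `rₖ`, the minimal cardinality of a `∼ᵏ`-equivalence class of edges. -/
def minClassSize (G : SimpleGraph V) [DecidableRel G.Adj] (k : ℕ) : ℕ :=
  sInf {c | ∃ e : Fin 2 → V, IsPath G e ∧ (edgeClass G k e).ncard = c}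

/-- `indₖ(Γ)`, the volume of the graph divided by `rₖ`. -/
def ind (G : SimpleGraph V) [DecidableRel G.Adj] (k : ℕ) : ℝ :=
  (volume G : ℝ) / (minClassSize G k : ℝ)

end QuantumGroup

end QSym

end

/-! Let `E` be the spectral projection of the normalized Laplacian for λ₁. The graph is regular of
some degree d, so `E` is a polynomial in the adjacency matrix and commutes with the magic unitary;
hence its entries are constant on orbitals (`apply_eq_apply_of_mul_ne_zero`). The squared distance
K(x,y) = E(x,x) + E(y,y) - 2E(x,y) in the spectral embedding is therefore constant on each class of
edges. With n = |V|, s = rank E and (a,b) an edge maximizing K, the Dirichlet energy gives r_k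
K(a,b) ≤ 2sdλ₁ (`minClassSize_mul_le`). The triangle inequality along geodesics gives K ≤ D²K(a,b)
on all pairs (`norm_sub_le_diam_mul`), while the sum of K over all pairs is 2ns, eigenvectors for λ₁
≠ 0 having mean zero. Eliminating K(a,b) yields r_k ≤ λ₁D²nd, and nd is the volume. -/

open Polynomial Matrix in
/-- The spectral projection of a real symmetric matrix onto an eigenspace is a polynomial in the
matrix. -/
theorem Matrix.IsHermitian.exists_aeval_eq_spectralProjection {V : Type*} [Fintype V]
    [DecidableEq V] {L : Matrix V V ℝ} (hL : L.IsHermitian) (μ : ℝ) :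
    ∃ p : ℝ[X], ∀ x y, aeval L p x y =
      ∑ i with hL.eigenvalues i = μ, hL.eigenvectorBasis i x * hL.eigenvectorBasis i y := by
  have key : ∀ (p : ℝ[X]) (i : V), aeval L p *ᵥ ⇑(hL.eigenvectorBasis i)
      = p.eval (hL.eigenvalues i) • ⇑(hL.eigenvectorBasis i) := by
    intro p i
    induction p using Polynomial.induction_on with
    | C a => simp [Algebra.algebraMap_eq_smul_one, Matrix.smul_mulVec]
    | add p q hp hq => simp [Matrix.add_mulVec, hp, hq, add_smul]
    | monomial n a h =>
      have h1 : aeval L (C a * X ^ (n + 1)) = aeval L (C a * X ^ n) * L := by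
        simp [pow_succ, mul_assoc]
      rw [h1, ← Matrix.mulVec_mulVec, hL.mulVec_eigenvectorBasis, Matrix.mulVec_smul, h, smul_smul]
      congr 1
      simp [pow_succ]
      ring
  -- Interpolate the indicator function of `μ` on the spectrum.
  refine ⟨Lagrange.interpolate (Finset.univ.image hL.eigenvalues) id
    (fun t => if t = μ then 1 else 0), fun x y => ?_⟩
  set p := Lagrange.interpolate (Finset.univ.image hL.eigenvalues) id
    (fun t => if t = μ then (1 : ℝ) else 0) with hp
  have hpe : ∀ i, p.eval (hL.eigenvalues i) = if hL.eigenvalues i = μ then 1 else 0 := fun i =>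
    Lagrange.eval_interpolate_at_node (v := id) (fun t => if t = μ then (1 : ℝ) else 0)
      Function.injective_id.injOn (Finset.mem_image_of_mem _ (Finset.mem_univ i))
  have hU : (hL.eigenvectorUnitary : Matrix V V ℝ) * star (hL.eigenvectorUnitary : Matrix V V ℝ)
      = 1 := Unitary.coe_mul_star_self _
  have h2 : aeval L p = aeval L p * (hL.eigenvectorUnitary : Matrix V V ℝ)
      * star (hL.eigenvectorUnitary : Matrix V V ℝ) := by
    rw [mul_assoc, hU, mul_one]
  rw [h2, Matrix.mul_apply, Finset.sum_filter]
  refine Finset.sum_congr rfl fun i _ => ?_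
  have h3 : (aeval L p * (hL.eigenvectorUnitary : Matrix V V ℝ)) x i
      = (aeval L p *ᵥ ⇑(hL.eigenvectorBasis i)) x := rfl
  rw [h3, key, hpe]
  simp [Matrix.star_apply]

/-! ### Orbitals of a magic unitary and matrices commuting with it -/

namespace QSym

/-- A real matrix that commutes with a magic unitary is constant on the orbitals of the latter. -/
theorem apply_eq_apply_of_mul_ne_zero {V B : Type*} [Fintype V] [DecidableEq V] [Ring B]
    [Algebra ℝ B] {q : V → V → B} (idem : ∀ i j, q i j * q i j = q i j)
    (row : ∀ i j l, j ≠ l → q i j * q i l = 0) (col : ∀ i j l, j ≠ l → q j i * q l i = 0)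
    {M : Matrix V V ℝ}
    (hM : Commute (Matrix.of q) ((Algebra.ofId ℝ B).mapMatrix M)) {a b c d : V}
    (h : q a c * q b d ≠ 0) : M a b = M c d := by
  have h1 := congrFun (congrFun hM.eq a) d
  simp only [Matrix.mul_apply, Matrix.of_apply, AlgHom.mapMatrix_apply, Matrix.map_apply,
    Algebra.ofId_apply, Algebra.algebraMap_eq_smul_one, mul_smul_comm, smul_mul_assoc, mul_one,
    one_mul] at h1
  -- Sandwiching the `(a, d)` entry of the commutation relation leaves only `t = c` on one side (row
  -- orthogonality) and `t = b` on the other (column orthogonality).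
  have h2 := congrArg (fun t => q a c * t * q b d) h1
  simp only [Finset.mul_sum, Finset.sum_mul, mul_smul_comm, smul_mul_assoc] at h2
  rw [Finset.sum_eq_single c (fun t _ ht => by rw [row a c t ht.symm]; simp) (by simp),
    Finset.sum_eq_single b (fun t _ ht => by rw [mul_assoc, col d t b ht]; simp) (by simp),
    idem, mul_assoc, idem, ← sub_eq_zero, ← sub_smul] at h2
  by_contra hne
  have hinv := congrArg (fun t => (M c d - M a b)⁻¹ • t) h2
  simp only [smul_smul, smul_zero] at hinv
  rw [inv_mul_cancel₀ (sub_ne_zero.2 (Ne.symm hne)), one_smul] at hinv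
  exact h hinv

theorem commute_mapMatrix_aeval {V B : Type*} [Fintype V] [DecidableEq V] [Ring B]
    [Algebra ℝ B] {Q : Matrix V V B} {M : Matrix V V ℝ}
    (hM : Commute Q ((Algebra.ofId ℝ B).mapMatrix M)) (p : Polynomial ℝ) :
    Commute Q ((Algebra.ofId ℝ B).mapMatrix (Polynomial.aeval M p)) := by
  rw [← Polynomial.aeval_algHom_apply]
  induction p using Polynomial.induction_on with
  | C a => rw [Polynomial.aeval_C]; exact (Algebra.commutes a Q).symm
  | add p q hp hq => simpa using hp.add_right hq
  | monomial n a h =>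
    simpa [pow_succ, mul_assoc] using h.mul_right hM

/-- A nonzero word of length two in the universal algebra is nonzero in some representation. -/
theorem exists_rep_of_pathEquiv {V : Type*} [Fintype V] {G : SimpleGraph V} [DecidableRel G.Adj]
    {k : ℕ} {e f : Fin 2 → V} (h : PathEquiv G k e f) :
    ∃ r : Rep G k, r.q (e 0) (f 0) * r.q (e 1) (f 1) ≠ 0 := by
  by_contra! hz
  apply h.2.2
  have h1 : word (gen G k) e f = gen G k (e 0) (f 0) * gen G k (e 1) (f 1) := by simp [word]
  rw [h1]
  apply Subtype.ext
  apply Subtype.ext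
  funext r
  exact hz r

/-- In a regular graph the normalized Laplacian is a multiple of the Laplacian. -/
theorem lapMatrix_eq_smul_normalizedLaplacian {V : Type*} [Fintype V] [DecidableEq V]
    {G : SimpleGraph V} [DecidableRel G.Adj] {d : ℕ} (hd : d ≠ 0)
    (hreg : G.IsRegularOfDegree d) : G.lapMatrix ℝ = (d : ℝ) • normalizedLaplacian G := by
  ext x y
  have hd' : (d : ℝ) ≠ 0 := by exact_mod_cast hd
  by_cases h : x = y
  · subst h
    simp [SimpleGraph.lapMatrix, SimpleGraph.degMatrix, normalizedLaplacian, hreg.degree_eq, hd]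
  · by_cases h' : G.Adj x y <;>
    simp [SimpleGraph.lapMatrix, SimpleGraph.degMatrix, normalizedLaplacian, hreg.degree_eq, h, h',
      hd']

/-- A polynomial in the normalized Laplacian of a regular graph is constant on the classes of
edges. -/
theorem aeval_normalizedLaplacian_eq {V : Type*} [Fintype V] [DecidableEq V]
    {G : SimpleGraph V} [DecidableRel G.Adj] {d : ℕ} (hd : d ≠ 0)
    (hreg : G.IsRegularOfDegree d) {k : ℕ} (r : Rep G k) (p : Polynomial ℝ) {a b a' b' : V}
    (h : r.q a a' * r.q b b' ≠ 0) :
    Polynomial.aeval (normalizedLaplacian G) p a b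
      = Polynomial.aeval (normalizedLaplacian G) p a' b' := by
  refine apply_eq_apply_of_mul_ne_zero r.rel.idem r.rel.row_orthogonal r.rel.col_orthogonal
    (commute_mapMatrix_aeval ?_ p) h
  have hd' : (d : ℝ) ≠ 0 := by exact_mod_cast hd
  -- Regularity makes the normalized Laplacian affine in the adjacency matrix, which commutes with
  -- `q` by definition.
  have h1 : normalizedLaplacian G = (1 : Matrix V V ℝ) - (d : ℝ)⁻¹ • G.adjMatrix ℝ := by
    have h2 : G.degMatrix ℝ = (d : ℝ) • 1 := by
      rw [SimpleGraph.degMatrix, Matrix.smul_one_eq_diagonal]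
      simp [hreg.degree_eq]
    rw [← inv_smul_smul₀ hd' (normalizedLaplacian G),
      ← lapMatrix_eq_smul_normalizedLaplacian hd hreg, SimpleGraph.lapMatrix, h2, smul_sub,
      inv_smul_smul₀ hd']
  have h3 : (Algebra.ofId ℝ r.carrier).mapMatrix (G.adjMatrix ℝ) = G.adjMatrix r.carrier := by
    ext x y
    simp [SimpleGraph.adjMatrix_apply, apply_ite]
  rw [h1, map_sub, map_smul, map_one, h3]
  exact (Commute.one_right _).sub_right (Commute.smul_right r.rel.commute_adj _)

/-- A map on a connected graph that expands edges by at most `c` has diameter at most `c` times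
the diameter of the graph. -/
theorem norm_sub_le_diam_mul {V E : Type*} [Fintype V] [Nonempty V] [NormedAddCommGroup E]
    {G : SimpleGraph V} (hconn : G.Connected)
    (g : V → E) {c : ℝ} (hc : ∀ x y, G.Adj x y → ‖g x - g y‖ ≤ c) (hc0 : 0 ≤ c) (x y : V) :
    ‖g x - g y‖ ≤ G.diam * c := by
  have hw : ∀ {x y : V} (w : G.Walk x y), ‖g x - g y‖ ≤ w.length * c := by
    intro x y w
    induction w with
    | nil => simp
    | @cons u v w h p ih =>
      calc ‖g u - g w‖ ≤ ‖g u - g v‖ + ‖g v - g w‖ := norm_sub_le_norm_sub_add_norm_sub _ _ _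
        _ ≤ c + p.length * c := add_le_add (hc _ _ h) ih
        _ = _ := by simp; ring
  obtain ⟨w, hl⟩ := hconn.exists_walk_length_eq_dist x y
  refine (hw w).trans ?_
  gcongr
  rw [hl]
  exact SimpleGraph.dist_le_diam (SimpleGraph.connected_iff_ediam_ne_top.1 hconn)

end QSym

namespace QSym

/-! ### Eigenvectors of the normalized Laplacian of a regular graph -/

section Eigen

open Matrix

variable {V : Type*} [Fintype V] [DecidableEq V] {G : SimpleGraph V} [DecidableRel G.Adj] {d : ℕ}

theorem sum_eigenvectorBasis_sq (i : V) :
    ∑ x, (normalizedLaplacian_isHermitian G).eigenvectorBasis i x ^ 2 = 1 := by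
  have h := (normalizedLaplacian_isHermitian G).eigenvectorBasis.orthonormal.1 i
  have h2 := EuclideanSpace.real_norm_sq_eq ((normalizedLaplacian_isHermitian G).eigenvectorBasis i)
  rw [← h2, h, one_pow]

theorem lapMatrix_mulVec_eigenvectorBasis (hd : d ≠ 0) (hreg : G.IsRegularOfDegree d) (i : V) :
    G.lapMatrix ℝ *ᵥ ⇑((normalizedLaplacian_isHermitian G).eigenvectorBasis i) =
      (d * (normalizedLaplacian_isHermitian G).eigenvalues i) •
        ⇑((normalizedLaplacian_isHermitian G).eigenvectorBasis i) := by
  rw [lapMatrix_eq_smul_normalizedLaplacian hd hreg, Matrix.smul_mulVec,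
    (normalizedLaplacian_isHermitian G).mulVec_eigenvectorBasis, smul_smul]

theorem toLinearMap₂'_lapMatrix_eigenvectorBasis (hd : d ≠ 0) (hreg : G.IsRegularOfDegree d)
    (i : V) :
    Matrix.toLinearMap₂' ℝ (G.lapMatrix ℝ)
      ⇑((normalizedLaplacian_isHermitian G).eigenvectorBasis i)
      ⇑((normalizedLaplacian_isHermitian G).eigenvectorBasis i)
      = d * (normalizedLaplacian_isHermitian G).eigenvalues i := by
  rw [Matrix.toLinearMap₂'_apply', lapMatrix_mulVec_eigenvectorBasis hd hreg, dotProduct_smul]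
  have h : ⇑((normalizedLaplacian_isHermitian G).eigenvectorBasis i) ⬝ᵥ
      ⇑((normalizedLaplacian_isHermitian G).eigenvectorBasis i) = 1 := by
    rw [← sum_eigenvectorBasis_sq (G := G) i]
    simp [dotProduct, sq]
  rw [h, smul_eq_mul, mul_one]

/-- The Dirichlet energy of a normalized eigenvector. -/
theorem sum_adj_sq_sub_eigenvectorBasis (hd : d ≠ 0) (hreg : G.IsRegularOfDegree d) (i : V) :
    (∑ x, ∑ y, if G.Adj x y then ((normalizedLaplacian_isHermitian G).eigenvectorBasis i x
      - (normalizedLaplacian_isHermitian G).eigenvectorBasis i y) ^ 2 else 0)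
      = 2 * (d * (normalizedLaplacian_isHermitian G).eigenvalues i) := by
  rw [← toLinearMap₂'_lapMatrix_eigenvectorBasis hd hreg, SimpleGraph.lapMatrix_toLinearMap₂']
  ring

theorem eigenvalues_nonneg (hd : d ≠ 0) (hreg : G.IsRegularOfDegree d) (i : V) :
    0 ≤ (normalizedLaplacian_isHermitian G).eigenvalues i := by
  have hd' : (0 : ℝ) < d := by positivity
  have h := sum_adj_sq_sub_eigenvectorBasis hd hreg i
  have h0 : 0 ≤ 2 * (d * (normalizedLaplacian_isHermitian G).eigenvalues i) := by
    rw [← h]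
    positivity
  nlinarith

/-- The constants lie in the kernel of the symmetric Laplacian, hence are orthogonal to all other
eigenspaces. -/
theorem sum_eigenvectorBasis_eq_zero (hd : d ≠ 0) (hreg : G.IsRegularOfDegree d) {i : V}
    (hi : (normalizedLaplacian_isHermitian G).eigenvalues i ≠ 0) :
    ∑ x, (normalizedLaplacian_isHermitian G).eigenvectorBasis i x = 0 := by
  have h1 := congrArg (fun v => (fun _ => (1 : ℝ)) ⬝ᵥ v)
    (lapMatrix_mulVec_eigenvectorBasis hd hreg i)
  have hd' : (d : ℝ) ≠ 0 := by exact_mod_cast hd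
  have h2 : (fun _ : V => (1 : ℝ)) ᵥ* G.lapMatrix ℝ = 0 := by
    rw [← Matrix.mulVec_transpose, (G.isSymm_lapMatrix (R := ℝ)).eq,
      SimpleGraph.lapMatrix_mulVec_const_eq_zero]
  simp only [dotProduct_mulVec, h2, zero_dotProduct, dotProduct_smul, smul_eq_mul] at h1
  have h3 := (mul_eq_zero.1 h1.symm).resolve_left (mul_ne_zero hd' hi)
  simpa [dotProduct] using h3

theorem exists_eigenvalues_eq_lambdaOne [Nontrivial V] (G : SimpleGraph V) [DecidableRel G.Adj] :
    ∃ i j, i ≠ j ∧ (normalizedLaplacian_isHermitian G).eigenvalues i = lambdaOne G ∧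
      (normalizedLaplacian_isHermitian G).eigenvalues j ≤ lambdaOne G := by
  let s : Fin (Fintype.card V) ≃ V := Fintype.equivOfCardEq (Fintype.card_fin _)
  -- `eigenvalues₀` is decreasing, so reversal turns positions 1 and 0 into λ₁ and λ₀.
  refine ⟨s (Fin.rev ⟨1, Fintype.one_lt_card⟩), s (Fin.rev ⟨0, Fintype.card_pos⟩), ?_, ?_, ?_⟩
  · simp [Fin.rev_inj]
  · simp [Matrix.IsHermitian.eigenvalues, lambdaOne, laplacianEigenvalue, s]
  · simp only [Matrix.IsHermitian.eigenvalues, lambdaOne, laplacianEigenvalue, s,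
      Equiv.symm_apply_apply]
    apply Matrix.IsHermitian.eigenvalues₀_antitone
    rw [Fin.rev_le_rev]
    simp

/-- Connectedness makes null vectors constant, and two nonzero constant vectors cannot be
orthogonal. -/
theorem lambdaOne_ne_zero [Nontrivial V] (hconn : G.Connected) (hd : d ≠ 0)
    (hreg : G.IsRegularOfDegree d) : lambdaOne G ≠ 0 := by
  intro h0
  obtain ⟨i, j, hij, hi, hj⟩ := exists_eigenvalues_eq_lambdaOne G
  rw [h0] at hi hj
  have hj := le_antisymm hj (eigenvalues_nonneg hd hreg j)
  have hconst : ∀ m, (normalizedLaplacian_isHermitian G).eigenvalues m = 0 → ∀ x y,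
      (normalizedLaplacian_isHermitian G).eigenvectorBasis m x
        = (normalizedLaplacian_isHermitian G).eigenvectorBasis m y := by
    intro m hm x y
    refine (G.lapMatrix_toLinearMap₂'_apply'_eq_zero_iff_forall_reachable _).1 ?_ x y
      (hconn.preconnected x y)
    rw [toLinearMap₂'_lapMatrix_eigenvectorBasis hd hreg, hm, mul_zero]
  obtain ⟨o⟩ := hconn.nonempty
  have horth := (normalizedLaplacian_isHermitian G).eigenvectorBasis.orthonormal.2 hij
  have hi1 := sum_eigenvectorBasis_sq (G := G) i
  have hj1 := sum_eigenvectorBasis_sq (G := G) j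
  simp only [PiLp.inner_apply, RCLike.inner_apply, conj_trivial] at horth
  simp only [fun x => hconst i hi x o, fun x => hconst j hj x o, Finset.sum_const,
    nsmul_eq_mul] at horth hi1 hj1
  rcases mul_eq_zero.1 horth with h | h
  · rw [h] at hi1
    simp at hi1
  · rcases mul_eq_zero.1 h with h | h
    · rw [h] at hj1
      simp at hj1
    · rw [h] at hi1
      simp at hi1

end Eigen

/-! ### Averaging over edge classes, and the final estimate -/

/-- A function on the pairs of vertices that is constant on the class of an edge `e` has there at
most the average value over all oriented edges, up to the size of the class. -/
theorem minClassSize_mul_le {V : Type*} [Fintype V] {G : SimpleGraph V} [DecidableRel G.Adj]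
    (k : ℕ) {K : V → V → ℝ} (hK : ∀ x y, 0 ≤ K x y) {a b : V} (hab : G.Adj a b)
    (hconst : ∀ f ∈ edgeClass G k ![a, b], K (f 0) (f 1) = K a b) :
    minClassSize G k * K a b ≤ ∑ x, ∑ y, if G.Adj x y then K x y else 0 := by
  classical
  have hpath : IsPath G ![a, b] := by
    intro s t hst
    fin_cases s <;> fin_cases t <;> simp_all
  have hle : minClassSize G k ≤ (edgeClass G k ![a, b]).ncard := Nat.sInf_le ⟨_, hpath, rfl⟩
  have hfin := (edgeClass G k ![a, b]).toFinite
  rw [Set.ncard_eq_toFinset_card _ hfin] at hle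
  calc (minClassSize G k : ℝ) * K a b ≤ (hfin.toFinset.card : ℝ) * K a b := by
        gcongr
        exact hK a b
    _ = ∑ f ∈ hfin.toFinset, if G.Adj (f 0) (f 1) then K (f 0) (f 1) else 0 := by
        rw [← nsmul_eq_mul, ← Finset.sum_const]
        refine Finset.sum_congr rfl fun f hf => ?_
        have hf' : f ∈ edgeClass G k ![a, b] := hfin.mem_toFinset.1 hf
        rw [if_pos (hf'.2.1 0 1 rfl), hconst f hf']
    _ ≤ ∑ f : Fin 2 → V, if G.Adj (f 0) (f 1) then K (f 0) (f 1) else 0 := by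
        refine Finset.sum_le_sum_of_subset_of_nonneg (Finset.subset_univ _) fun f _ _ => ?_
        split_ifs
        exacts [hK _ _, le_rfl]
    _ = ∑ z : V × V, if G.Adj z.1 z.2 then K z.1 z.2 else 0 :=
        Fintype.sum_equiv (finTwoArrowEquiv V) _ _ fun f => by simp [finTwoArrowEquiv]
    _ = _ := Fintype.sum_prod_type _

theorem IsVertexTransitive.isRegularOfDegree {V : Type*} [Fintype V] {G : SimpleGraph V}
    [DecidableRel G.Adj] (h : IsVertexTransitive G) (o : V) :
    G.IsRegularOfDegree (G.degree o) := by
  intro x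
  obtain ⟨φ, hφ⟩ := h x o
  rw [← hφ, φ.degree_eq]

end QSym

theorem theorem3 {V : Type*} [Fintype V] [DecidableEq V] [Nontrivial V]
    (G : SimpleGraph V) [DecidableRel G.Adj]
    (hconn : G.Connected) (htrans : QSym.IsVertexTransitive G)
    (k : ℕ) (hD : G.diam ≤ 2 * k + 1) :
    1 / ((G.diam : ℝ) ^ 2 * QSym.ind G k) ≤ QSym.lambdaOne G := by
  classical
  obtain ⟨o⟩ := hconn.nonempty
  set d := G.degree o with hd_def
  have hreg : G.IsRegularOfDegree d := htrans.isRegularOfDegree o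
  have hd : d ≠ 0 := (hconn.preconnected.degree_pos_of_nontrivial o).ne'
  set hL := QSym.normalizedLaplacian_isHermitian G
  set lam := QSym.lambdaOne G
  have hlam : lam ≠ 0 := QSym.lambdaOne_ne_zero hconn hd hreg
  obtain ⟨i₀, -, -, hi₀, -⟩ := QSym.exists_eigenvalues_eq_lambdaOne G
  obtain ⟨p, hp⟩ := hL.exists_aeval_eq_spectralProjection lam
  set S : Finset V := {i | hL.eigenvalues i = lam} with hS
  have hSmem : ∀ i, i ∈ S ↔ hL.eigenvalues i = lam := fun i => by simp [hS]
  have hScard : 0 < (S.card : ℝ) := by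
    exact_mod_cast Finset.card_pos.2 ⟨i₀, (hSmem i₀).2 hi₀⟩
  -- Summing over the whole eigenspace makes `K` a function of the spectral projection alone; a
  -- single eigenvector would not give invariance on classes.
  set K : V → V → ℝ := fun x y => ∑ i ∈ S, (hL.eigenvectorBasis i x - hL.eigenvectorBasis i y) ^ 2
    with hK_def
  have hK0 : ∀ x y, 0 ≤ K x y := fun x y => Finset.sum_nonneg fun i _ => sq_nonneg _
  have hKE : ∀ x y, K x y = Polynomial.aeval (QSym.normalizedLaplacian G) p x x
      + Polynomial.aeval (QSym.normalizedLaplacian G) p y y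
      - 2 * Polynomial.aeval (QSym.normalizedLaplacian G) p x y := by
    intro x y
    rw [hp, hp, hp, Finset.mul_sum, ← Finset.sum_add_distrib, ← Finset.sum_sub_distrib]
    exact Finset.sum_congr rfl fun i _ => by ring
  obtain ⟨b₀, hb₀⟩ : ∃ b, G.Adj o b := by
    exact (G.degree_pos_iff_exists_adj o).1 (Nat.pos_of_ne_zero hd)
  obtain ⟨⟨a, b⟩, habm, hmax⟩ := Finset.exists_max_image
    (Finset.univ.filter fun z : V × V => G.Adj z.1 z.2) (fun z => K z.1 z.2)
    ⟨(o, b₀), by simpa using hb₀⟩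
  have hab : G.Adj a b := by simpa using habm
  have hmax' : ∀ x y, G.Adj x y → K x y ≤ K a b := fun x y h => hmax (x, y) (by simpa using h)
  have hedges : (∑ x, ∑ y, if G.Adj x y then K x y else 0) = S.card * (2 * (d * lam)) := by
    rw [← nsmul_eq_mul, ← Finset.sum_const]
    calc _ = ∑ x, ∑ y, ∑ i ∈ S, if G.Adj x y then
          (hL.eigenvectorBasis i x - hL.eigenvectorBasis i y) ^ 2 else 0 := by
          refine Finset.sum_congr rfl fun x _ => Finset.sum_congr rfl fun y _ => ?_
          split_ifs <;> simp [hK_def]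
      _ = ∑ i ∈ S, ∑ x, ∑ y, if G.Adj x y then
          (hL.eigenvectorBasis i x - hL.eigenvectorBasis i y) ^ 2 else 0 := by
          rw [Finset.sum_congr rfl fun x _ => Finset.sum_comm, Finset.sum_comm]
      _ = _ := Finset.sum_congr rfl fun i hi => by
          rw [QSym.sum_adj_sq_sub_eigenvectorBasis hd hreg i, (hSmem i).1 hi]
  have hpairs : ∑ x, ∑ y, K x y = S.card * (2 * Fintype.card V) := by
    rw [← nsmul_eq_mul, ← Finset.sum_const]
    simp only [hK_def]
    rw [Finset.sum_congr rfl fun x _ => Finset.sum_comm, Finset.sum_comm]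
    refine Finset.sum_congr rfl fun i hi => ?_
    have h1 := QSym.sum_eigenvectorBasis_sq (G := G) i
    have h2 := QSym.sum_eigenvectorBasis_eq_zero hd hreg (i := i) (by rwa [(hSmem i).1 hi])
    simp only [sub_sq, Finset.sum_add_distrib, Finset.sum_sub_distrib, Finset.sum_const,
      ← Finset.mul_sum, h1, h2, Finset.card_univ, nsmul_eq_mul]
    simp only [mul_zero, Finset.sum_const_zero, sub_zero]
    ring
  have hclass : QSym.minClassSize G k * K a b ≤ S.card * (2 * (d * lam)) := by
    rw [← hedges]
    refine QSym.minClassSize_mul_le k hK0 hab fun f hf => ?_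
    obtain ⟨r, hr⟩ := QSym.exists_rep_of_pathEquiv hf
    simp only [Matrix.cons_val_zero, Matrix.cons_val_one] at hr
    -- `K` also involves diagonal entries of the projection; idempotency puts the orbitals of `(a,
    -- a)` and `(b, b)` in the form of the same lemma.
    have h1 : r.q a (f 0) * r.q a (f 0) ≠ 0 := by
      rw [r.rel.idem]
      exact left_ne_zero_of_mul hr
    have h2 : r.q b (f 1) * r.q b (f 1) ≠ 0 := by
      rw [r.rel.idem]
      exact right_ne_zero_of_mul hr
    rw [hKE, hKE, QSym.aeval_normalizedLaplacian_eq hd hreg r p hr,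
      QSym.aeval_normalizedLaplacian_eq hd hreg r p h1,
      QSym.aeval_normalizedLaplacian_eq hd hreg r p h2]
  have hdiam : ∀ x y, K x y ≤ (G.diam : ℝ) ^ 2 * K a b := by
    -- The spectral embedding: `K` is its squared distance, whence the square of the diameter.
    let g : V → EuclideanSpace ℝ S := fun x => WithLp.toLp 2 fun i => hL.eigenvectorBasis i x
    have hg : ∀ x y, K x y = ‖g x - g y‖ ^ 2 := by
      intro x y
      rw [EuclideanSpace.real_norm_sq_eq]
      simp only [g, hK_def, PiLp.sub_apply]
      exact (Finset.sum_coe_sort S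
        fun i => (hL.eigenvectorBasis i x - hL.eigenvectorBasis i y) ^ 2).symm
    intro x y
    have h := QSym.norm_sub_le_diam_mul hconn g (c := ‖g a - g b‖) (fun x y h => by
      have := hmax' x y h
      rw [hg, hg] at this
      exact le_of_sq_le_sq this (norm_nonneg _)) (norm_nonneg _) x y
    rw [hg, hg, ← mul_pow]
    gcongr
  have htotal : S.card * (2 * (Fintype.card V : ℝ))
      ≤ Fintype.card V * (Fintype.card V * ((G.diam : ℝ) ^ 2 * K a b)) := by
    rw [← hpairs]
    calc ∑ x, ∑ y, K x y ≤ ∑ _x : V, ∑ _y : V, (G.diam : ℝ) ^ 2 * K a b :=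
          Finset.sum_le_sum fun x _ => Finset.sum_le_sum fun y _ => hdiam x y
      _ = _ := by simp
  have hn : (0 : ℝ) < Fintype.card V := by exact_mod_cast Fintype.card_pos
  have hdpos : (0 : ℝ) < d := by positivity
  have hDpos : (0 : ℝ) < G.diam := by
    exact_mod_cast Nat.pos_of_ne_zero (SimpleGraph.connected_iff_diam_ne_zero.1 hconn)
  have hvol : (QSym.volume G : ℝ) = Fintype.card V * d := by
    simp [QSym.volume, hreg.degree_eq]
  have hr0 : (0 : ℝ) ≤ QSym.minClassSize G k := Nat.cast_nonneg _
  have hfinal : (QSym.minClassSize G k : ℝ)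
      ≤ lam * ((G.diam : ℝ) ^ 2 * (Fintype.card V * d)) := by
    have h1 : 2 * (S.card : ℝ) ≤ Fintype.card V * ((G.diam : ℝ) ^ 2 * K a b) := by
      refine le_of_mul_le_mul_left ?_ hn
      linarith
    have h2 := mul_le_mul_of_nonneg_left h1 hr0
    have h3 := mul_le_mul_of_nonneg_left hclass
      (by positivity : 0 ≤ (Fintype.card V : ℝ) * (G.diam : ℝ) ^ 2)
    refine le_of_mul_le_mul_left ?_ (by positivity : 0 < 2 * (S.card : ℝ))
    linarith
  have hform : 1 / ((G.diam : ℝ) ^ 2 * QSym.ind G k)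
      = QSym.minClassSize G k / ((G.diam : ℝ) ^ 2 * (Fintype.card V * d)) := by
    rw [QSym.ind, hvol, mul_div_assoc', one_div_div]
  rw [hform, div_le_iff₀ (by positivity)]
  exact hfinal
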